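/- Let $N\ge 2$, let $a_0,\dots,a_N,b_1,\dots,b_N\in\mathbb{R}$ with $a_N\neq 0$ or $b_N\neq 0$, and let $$p(\theta)=a_0+\sum_{k=1}^{N}\bigl(a_k\cos k\theta+b_k\sin k\theta\bigr).$$ Let $\mathcal C\subset\mathbb{R}^2$ be the image of $[-\pi,\pi]$ under $$\gamma(\theta)=\bigl(p(\theta)\cos\theta-p'(\theta)\sin\theta,\; p(\theta)\sin\theta+p'(\theta)\cos\theta\bigr).$$ A defining polynomial of $\mathcal C$ is an irreducible $f\in\mathbb{R}[x,y]$ that generates the ideal of all polynomials in $\mathbb{R}[x,y]$ vanishing on $\mathcal C$ (so it is unique up to a nonzero constant factor). (i) If $a_0\neq 0$, or if there is $k\ge 1$ with $2k\le N$ such that $a_{2k}\neq0$ or $b_{2k}\neq 0$, then $\mathcal C$ has a defining polynomial, and every defining polynomial of $\mathcal C$ has total degree $2N+2$. (ii) If $a_0=0$ and $a_{2k}=b_{2k}=0$ for all $k\ge 1$ with $2k\le N$, then $\gamma$ traces $\mathcal C$ twice, that is, for all but finitely many $\theta\in(-\pi,\pi]$ there are exactly two $s\in(-\pi,\pi]$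 with $\gamma(s)=\gamma(\theta)$; moreover $\mathcal C$ has a defining polynomial, and every defining polynomial of $\mathcal C$ has total degree $N+1$. -/

import Mathlib

noncomputable section

/-- The trigonometric polynomial
`p(θ) = a₀ + ∑_{1 ≤ k ≤ N} (a_k cos kθ + b_k sin kθ)`; only `a 0, …, a N` and `b 1, …, b N`
are used. -/
def trigPoly (N : ℕ) (a b : ℕ → ℝ) (θ : ℝ) : ℝ :=
  a 0 + ∑ k ∈ Finset.Icc 1 N, (a k * Real.cos (k * θ) + b k * Real.sin (k * θ))

/-- The parametrization `θ ↦ (p cos θ - p' sin θ, p sin θ + p' cos θ)`. -/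
def supportParam (p : ℝ → ℝ) (θ : ℝ) : Fin 2 → ℝ :=
  ![p θ * Real.cos θ - deriv p θ * Real.sin θ, p θ * Real.sin θ + deriv p θ * Real.cos θ]

/-- The plane curve traced by `supportParam p` for `θ ∈ [-π, π]`. -/
def supportCurve (p : ℝ → ℝ) : Set (Fin 2 → ℝ) :=
  supportParam p '' Set.Icc (-Real.pi) Real.pi

/-- `f ∈ ℝ[x, y]` is a defining polynomial of the plane set `C`: it is irreducible and generates
the ideal of all polynomials vanishing on `C`. -/
def IsDefiningPolynomial (C : Set (Fin 2 → ℝ)) (f : MvPolynomial (Fin 2) ℝ) : Prop :=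
  Irreducible f ∧ MvPolynomial.vanishingIdeal ℝ C = Ideal.span {f}

/-- The `2π`-periodic parametrization `γ` traces its image `q` times: for all but finitely many
parameters `θ` in a period, exactly `q` parameters in that period have the same image as `θ`.
(To be used with `q ≥ 1`, where `ncard = q` forces finiteness.) -/
def TracesTimes (γ : ℝ → Fin 2 → ℝ) (q : ℕ) : Prop :=
  {θ ∈ Set.Ioc (-Real.pi) Real.pi |
    {s ∈ Set.Ioc (-Real.pi) Real.pi | γ s = γ θ}.ncard ≠ q}.Finite

end

/-!
Write `T = e^{iθ}`, so that the coordinates of the curve become Laurent polynomials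
`x, y ∈ ℂ[T, T⁻¹]` with poles of order at most `n = N + 1` at `0` and `∞`. The vanishing ideal is
the kernel of the substitution of `x` and `y`; it is prime and not maximal, hence principal once it
is nonzero. A relation of degree at most `2 n` between `x` and `y` is the determinant of a matrix
pencil, and if `ℂ(x, y) = ℂ(T)`, then no relation has smaller degree, because `[ℂ(T) : ℂ(y)] = 2 n`.

Since the tangent at parameter `θ` has direction `(-sin θ, cos θ)`, differentiating `f(x, y) = 0`
expresses `T²` as a rational function of `x` and `y`. So `ℂ(x, y) = ℂ(T)` unless `x` and `y` are
both polynomials in `T^{±2}`, which happens exactly when the even Fourier coefficients of `p`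
vanish. In that case `T²` is a birational parameter, the curve is traced twice, and `n` is halved.
-/

open scoped Polynomial LaurentPolynomial

section LaurentTools

open Polynomial (toLaurent)
open LaurentPolynomial

section LaurentEval

variable {R A : Type*} [CommSemiring R] [CommSemiring A] [Algebra R A]

/-- Evaluation of Laurent polynomials at a unit of an algebra. -/
noncomputable def laurentAeval (u : Aˣ) : R[T;T⁻¹] →ₐ[R] A where
  __ := LaurentPolynomial.eval₂ (algebraMap R A) u
  commutes' r := eval₂_C (algebraMap R A) u r

@[simp]
theorem laurentAeval_T (u : Aˣ) (k : ℤ) : laurentAeval u (T k : R[T;T⁻¹]) = ↑(u ^ k) :=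
  eval₂_T _ u k

@[simp]
theorem laurentAeval_C (u : Aˣ) (r : R) : laurentAeval u (C r) = algebraMap R A r :=
  eval₂_C _ u r

@[simp]
theorem laurentAeval_toLaurent (u : Aˣ) (p : R[X]) :
    laurentAeval u (toLaurent p) = Polynomial.aeval (u : A) p :=
  eval₂_toLaurent _ u p

end LaurentEval

section LaurentRing

variable {R A : Type*} [CommRing R] [CommRing A] [Algebra R A]

theorem laurentAeval_injective {u : Aˣ} (hu : Transcendental R (u : A)) :
    Function.Injective (laurentAeval u : R[T;T⁻¹] → A) := by
  refine (injective_iff_map_eq_zero _).2 fun P hP => ?_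
  obtain ⟨n, p, hp⟩ := exists_T_pow P
  have hroot : Polynomial.aeval (u : A) p = 0 := by
    rw [← laurentAeval_toLaurent, hp, map_mul, hP, zero_mul]
  rw [(transcendental_iff.1 hu) p hroot, map_zero] at hp
  exact ((isUnit_T n).mul_left_eq_zero).1 hp.symm

theorem finite_setOf_laurentAeval_eq_zero [IsDomain R] [IsDomain A] [Module.IsTorsionFree R A]
    {P : R[T;T⁻¹]} (hP : P ≠ 0) : {u : Aˣ | laurentAeval u P = 0}.Finite := by
  obtain ⟨n, p, hp⟩ := exists_T_pow P
  have hp0 : p ≠ 0 := by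
    rintro rfl
    exact hP (((isUnit_T n).mul_left_eq_zero).1 (by rw [← hp, map_zero]))
  refine ((p.rootSet_finite A).preimage Units.val_injective.injOn).subset fun u hu => ?_
  rw [Set.mem_preimage, Polynomial.mem_rootSet_of_ne hp0, ← laurentAeval_toLaurent, hp, map_mul,
    hu, zero_mul]

end LaurentRing

theorem laurentAeval_mem {K F : Type*} [Field K] [Field F] [Algebra K F]
    (M : IntermediateField K F) {u : Fˣ} (hu : (u : F) ∈ M) (P : K[T;T⁻¹]) :
    laurentAeval u P ∈ M := by
  induction P using LaurentPolynomial.induction_on' with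
  | add p q hp hq => rw [map_add]; exact add_mem hp hq
  | C_mul_T n a =>
    rw [map_mul, laurentAeval_C, laurentAeval_T, Units.val_zpow_eq_zpow_val]
    exact mul_mem (M.algebraMap_mem a) (zpow_mem hu n)

section Coeff

variable {R : Type*} [CommSemiring R]

theorem coeff_T_mul (n : ℤ) (P : R[T;T⁻¹]) (k : ℤ) : (T n * P).coeff k = P.coeff (k - n) := by
  rw [T, AddMonoidAlgebra.coeff_single_mul_eq_mul_coeff (k - n) fun m _ => by lia, one_mul]

theorem coeff_C_mul (r : R) (P : R[T;T⁻¹]) (k : ℤ) :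
    (C r * P).coeff k = r * P.coeff k := by
  rw [← smul_eq_C_mul, AddMonoidAlgebra.coeff_smul, Finsupp.smul_apply, smul_eq_mul]

/-- The substitution `P(T) ↦ P(T²)`, whose range detects the curves that are traced twice. -/
noncomputable def substSq : R[T;T⁻¹] →ₐ[R] R[T;T⁻¹] :=
  AddMonoidAlgebra.mapDomainAlgHom R R (AddMonoidHom.mulLeft (2 : ℤ))

theorem mulLeft_two_injective : Function.Injective (AddMonoidHom.mulLeft (2 : ℤ)) :=
  mul_right_injective₀ two_ne_zero

theorem substSq_T (k : ℤ) : substSq (T k : R[T;T⁻¹]) = T (2 * k) :=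
  AddMonoidAlgebra.mapDomain_single

theorem substSq_injective : Function.Injective (substSq : R[T;T⁻¹] → R[T;T⁻¹]) :=
  AddMonoidAlgebra.mapDomain_injective mulLeft_two_injective

theorem coeff_substSq_even (P : R[T;T⁻¹]) (k : ℤ) : (substSq P).coeff (2 * k) = P.coeff k :=
  Finsupp.mapDomain_apply mulLeft_two_injective _ k

theorem coeff_substSq_odd (P : R[T;T⁻¹]) {k : ℤ} (hk : Odd k) : (substSq P).coeff k = 0 :=
  Finsupp.mapDomain_of_notMem_range _ k <| by
    rintro ⟨m, rfl⟩
    exact Int.not_odd_iff_even.2 (even_two_mul m) hk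

theorem mem_range_substSq_iff {P : R[T;T⁻¹]} :
    P ∈ Set.range substSq ↔ ∀ k, Odd k → P.coeff k = 0 := by
  refine ⟨fun ⟨Q, hQ⟩ k hk => hQ ▸ coeff_substSq_odd Q hk, fun h => ?_⟩
  refine ⟨_, AddMonoidAlgebra.mapDomain_comapDomain (fun k hk => ?_) mulLeft_two_injective⟩
  obtain ⟨m, rfl⟩ := (Int.not_odd_iff_even.1 (mt (h k) (Finsupp.mem_support_iff.1 hk))).two_dvd
  exact ⟨m, rfl⟩

theorem exists_eq_substSq_add (P : R[T;T⁻¹]) :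
    ∃ E O : R[T;T⁻¹], P = substSq E + T 1 * substSq O := by
  induction P using LaurentPolynomial.induction_on' with
  | add P Q hP hQ =>
    obtain ⟨E, O, rfl⟩ := hP
    obtain ⟨E', O', rfl⟩ := hQ
    exact ⟨E + E', O + O', by simp only [map_add]; ring⟩
  | C_mul_T n r =>
    rw [← smul_eq_C_mul]
    obtain ⟨m, rfl | rfl⟩ := n.even_or_odd'
    · exact ⟨r • T m, 0, by simp [substSq_T]⟩
    · exact ⟨0, r • T m, by
        rw [map_zero, zero_add, map_smul, substSq_T, mul_smul_comm, ← T_add, add_comm]⟩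

theorem laurentAeval_substSq {A : Type*} [CommSemiring A] [Algebra R A] (u : Aˣ) (P : R[T;T⁻¹]) :
    laurentAeval u (substSq P) = laurentAeval (u ^ 2) P := by
  induction P using LaurentPolynomial.induction_on' with
  | add P Q hP hQ => simp only [map_add, hP, hQ]
  | C_mul_T n r =>
    simp only [← smul_eq_C_mul, map_smul, substSq_T, laurentAeval_T, zpow_mul,
      zpow_ofNat]

theorem coeff_toLaurent_natCast (p : R[X]) (j : ℕ) : (toLaurent p).coeff j = p.coeff j := by
  rw [coeff_toLaurent]
  exact Finsupp.mapDomain_apply Nat.cast_injective _ j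

theorem exists_toLaurent_eq {P : R[T;T⁻¹]} (hP : ∀ k < 0, P.coeff k = 0) :
    ∃ p : R[X], toLaurent p = P := by
  have hsupp : ↑P.coeff.support ⊆ Set.range (Nat.cast : ℕ → ℤ) := fun k hk =>
    ⟨k.toNat, Int.toNat_of_nonneg (not_lt.1 fun h => Finsupp.mem_support_iff.1 hk (hP k h))⟩
  exact ⟨⟨AddMonoidAlgebra.comapDomain _ Nat.cast_injective P⟩,
    AddMonoidAlgebra.mapDomain_comapDomain hsupp Nat.cast_injective⟩

theorem exists_toLaurent_eq_T_mul {n : ℕ} {P : R[T;T⁻¹]}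
    (hP : ∀ k : ℤ, n < k.natAbs → P.coeff k = 0) :
    ∃ p : R[X], toLaurent p = T n * P ∧ p.natDegree ≤ 2 * n ∧
      p.coeff 0 = P.coeff (-n) ∧ p.coeff (2 * n) = P.coeff n := by
  obtain ⟨p, hp⟩ : ∃ p : R[X], toLaurent p = T n * P :=
    exists_toLaurent_eq fun k hk => by rw [coeff_T_mul, hP _ (by lia)]
  have hcoeff (j : ℕ) : p.coeff j = P.coeff (j - n) := by
    rw [← coeff_toLaurent_natCast, hp, coeff_T_mul]
  refine ⟨p, hp, Polynomial.natDegree_le_iff_coeff_eq_zero.2 fun j hj => ?_, ?_, ?_⟩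
  · rw [hcoeff, hP _ (by lia)]
  · rw [hcoeff]; simp
  · rw [hcoeff]; congr 1; push_cast; ring

end Coeff

section Derivation

variable {R : Type*} [CommRing R]

/-- The operator `T d/dT` on Laurent polynomials, as a linear map; bundled as a derivation in
`eulerDerivation`. -/
noncomputable def eulerLinearMap : R[T;T⁻¹] →ₗ[R] R[T;T⁻¹] :=
  Finsupp.linearCombination R (fun k : ℤ => (k : R) • (T k : R[T;T⁻¹])) ∘ₗ
    (AddMonoidAlgebra.coeffLinearEquiv R).toLinearMap

theorem eulerLinearMap_C_mul_T (r : R) (k : ℤ) :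
    eulerLinearMap (C r * T k) = C (r * k) * T k := by
  rw [← single_eq_C_mul_T, ← smul_eq_C_mul, mul_smul]
  exact Finsupp.linearCombination_single R r k

/-- The derivation `T d/dT` of the Laurent polynomials; it is `-i d/dθ` for `T = e^{iθ}`. -/
noncomputable def eulerDerivation : Derivation R R[T;T⁻¹] R[T;T⁻¹] :=
  .mk' eulerLinearMap fun P Q => by
    induction P using LaurentPolynomial.induction_on' with
    | add P P' hP hP' => rw [add_mul, map_add, hP, hP', map_add, add_smul, smul_add]; abel
    | C_mul_T n r =>
      induction Q using LaurentPolynomial.induction_on' with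
      | add Q Q' hQ hQ' => rw [mul_add, map_add, hQ, hQ', map_add, add_smul, smul_add]; abel
      | C_mul_T m s =>
        have hmul : C r * T n * (C s * T m) =
            C (r * s) * T (n + m) := by rw [map_mul, T_add]; ring
        rw [hmul, eulerLinearMap_C_mul_T, eulerLinearMap_C_mul_T, eulerLinearMap_C_mul_T]
        simp only [smul_eq_mul, map_mul, T_add, Int.cast_add, map_add]
        ring

theorem eulerDerivation_T (k : ℤ) :
    eulerDerivation (T k : R[T;T⁻¹]) = C (k : R) * T k := by
  have h : eulerDerivation (C 1 * T k : R[T;T⁻¹]) = _ :=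
    eulerLinearMap_C_mul_T 1 k
  simpa only [map_one, one_mul] using h

theorem coeff_eulerDerivation (P : R[T;T⁻¹]) (k : ℤ) :
    (eulerDerivation P).coeff k = k * P.coeff k := by
  induction P using LaurentPolynomial.induction_on' with
  | add P Q hP hQ =>
    simp only [map_add, AddMonoidAlgebra.coeff_add, Finsupp.add_apply, hP, hQ, mul_add]
  | C_mul_T n r =>
    rw [← smul_eq_C_mul, Derivation.map_smul, eulerDerivation_T,
      ← smul_eq_C_mul]
    obtain rfl | h := eq_or_ne n k
    · simp [mul_comm]
    · simp [h]

end Derivation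

end LaurentTools

section Relation

open Polynomial in
theorem exists_eq_mul_add_mul_of_natDegree_lt {K : Type*} [Field K] {p r h : K[X]}
    (hpr : IsCoprime p r) (hr : r.natDegree ≤ p.natDegree) (hh : h.natDegree < 2 * p.natDegree) :
    ∃ a b : K[X], h = p * a + r * b ∧ a.natDegree < p.natDegree ∧ b.natDegree < p.natDegree := by
  have hp : 0 < p.natDegree := by lia
  have hp0 : p ≠ 0 := ne_zero_of_natDegree_gt hp
  obtain ⟨u, v, huv⟩ := hpr
  obtain ⟨b, hb, a, ha⟩ : ∃ b : K[X], b.natDegree < p.natDegree ∧ p ∣ h - r * b := by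
    refine ⟨h * v % p, natDegree_mod_lt _ hp.ne', h * u + r * (h * v / p), ?_⟩
    linear_combination -h * huv - r * EuclideanDomain.div_add_mod (h * v) p
  refine ⟨a, b, by rw [← ha]; ring, ?_, hb⟩
  obtain rfl | ha0 := eq_or_ne a 0
  · simpa using hp
  have hdeg : (p * a).natDegree < 2 * p.natDegree := by
    rw [← ha]
    refine (natDegree_sub_le _ _).trans_lt (max_lt hh (natDegree_mul_le.trans_lt ?_))
    lia
  rw [natDegree_mul hp0 ha0] at hdeg
  lia

open MvPolynomial

variable {ι K : Type*} [Fintype ι] [DecidableEq ι] [CommRing K]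

/-- The linear matrix pencil `X₀ - M - X₁ M'`. Its determinant is a relation between `x` and `y`
whenever `x - M - y M'` has a nonzero kernel. -/
noncomputable def matrixPencil (M M' : Matrix ι ι K) : Matrix ι ι (MvPolynomial (Fin 2) K) :=
  .of fun i k => (if i = k then X 0 else 0) - C (M i k) - X 1 * C (M' i k)

theorem det_matrixPencil_ne_zero [Nontrivial K] (M M' : Matrix ι ι K) :
    (matrixPencil M M').det ≠ 0 := by
  intro h
  have hchar : aeval ![Polynomial.X, 0] (matrixPencil M M').det = M.charpoly := by
    rw [AlgHom.map_det, Matrix.charpoly]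
    congr 1
    ext1 i k
    obtain rfl | hik := eq_or_ne i k
    · simp [matrixPencil]
    · simp [matrixPencil, hik]
  rw [h, map_zero] at hchar
  exact M.charpoly_monic.ne_zero hchar.symm

theorem totalDegree_det_matrixPencil_le [Nontrivial K] (M M' : Matrix ι ι K) :
    (matrixPencil M M').det.totalDegree ≤ Fintype.card ι := by
  have hentry (i k : ι) : (matrixPencil M M' i k).totalDegree ≤ 1 := by
    refine (totalDegree_sub _ _).trans (max_le ((totalDegree_sub _ _).trans (max_le ?_ ?_)) ?_)
    · split_ifs <;> simp
    · simp
    · exact (totalDegree_mul _ _).trans (by simp)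
  rw [Matrix.det_apply]
  refine totalDegree_finsetSum_le fun σ _ => (totalDegree_smul_le _ _).trans ?_
  refine (totalDegree_finsetProd _ _).trans ?_
  exact (Finset.sum_le_card_nsmul _ _ 1 fun i _ => hentry _ _).trans (by simp)

theorem aeval_det_matrixPencil_eq_zero {A : Type*} [CommRing A] [IsDomain A] [Algebra K A]
    {M M' : Matrix ι ι K} {x y : A} {v : ι → A} (hv : v ≠ 0)
    (h : ∀ i, x * v i = ∑ k, M i k • v k + y * ∑ k, M' i k • v k) :
    aeval ![x, y] (matrixPencil M M').det = 0 := by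
  rw [AlgHom.map_det, ← Matrix.exists_mulVec_eq_zero_iff]
  refine ⟨v, hv, funext fun i => ?_⟩
  calc ∑ k, aeval ![x, y] (matrixPencil M M' i k) * v k
      = ∑ k, ((if i = k then x * v k else 0) - M i k • v k - y * (M' i k • v k)) :=
        Finset.sum_congr rfl fun k _ => by
          simp [matrixPencil, apply_ite (aeval _), Algebra.smul_def, sub_mul, mul_assoc]
    _ = x * v i - ∑ k, M i k • v k - y * ∑ k, M' i k • v k := by
        simp [Finset.sum_sub_distrib, Finset.mul_sum]
    _ = 0 := by rw [h i]; ring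

theorem exists_aeval_eq_zero_totalDegree_le {K A : Type*} [Field K] [CommRing A] [IsDomain A]
    [Algebra K A] {p q r : K[X]} (hpr : IsCoprime p r)
    (hp : 0 < p.natDegree) (hq : q.natDegree ≤ p.natDegree) (hr : r.natDegree ≤ p.natDegree)
    {t x y : A} (ht : Polynomial.aeval t r ≠ 0)
    (hx : x * Polynomial.aeval t r = Polynomial.aeval t q)
    (hy : y * Polynomial.aeval t r = Polynomial.aeval t p) :
    ∃ g : MvPolynomial (Fin 2) K,
      g ≠ 0 ∧ g.totalDegree ≤ p.natDegree ∧ aeval ![x, y] g = 0 := by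
  have hdiv (i : Fin p.natDegree) := exists_eq_mul_add_mul_of_natDegree_lt (h := q * .X ^ (i : ℕ))
    hpr hr (Polynomial.natDegree_mul_le.trans_lt (by rw [Polynomial.natDegree_X_pow]; lia))
  choose a b hab ha hb using hdiv
  refine ⟨(matrixPencil (.of fun i k : Fin p.natDegree => (b i).coeff k)
    (.of fun i k => (a i).coeff k)).det, det_matrixPencil_ne_zero _ _,
    (totalDegree_det_matrixPencil_le _ _).trans_eq (Fintype.card_fin _),
    aeval_det_matrixPencil_eq_zero (v := fun i => t ^ (i : ℕ))
      (fun h => one_ne_zero ((pow_zero t).symm.trans (congrFun h ⟨0, hp⟩))) fun i => ?_⟩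
  have haeval {c : K[X]} (hc : c.natDegree < p.natDegree) :
      ∑ k : Fin p.natDegree, c.coeff k • t ^ (k : ℕ) = Polynomial.aeval t c := by
    rw [Polynomial.aeval_eq_sum_range' hc, Finset.sum_range]
  refine mul_right_cancel₀ ht ?_
  have := congrArg (Polynomial.aeval t) (hab i)
  simp only [map_mul, map_add, map_pow, Polynomial.aeval_X] at this
  simp only [Matrix.of_apply, haeval (ha i), haeval (hb i)]
  linear_combination this + t ^ (i : ℕ) * hx - Polynomial.aeval t (a i) * hy

end Relation

section Birational

open IntermediateField

theorem finrank_adjoin_le_totalDegree {K F : Type*} [Field K] [Field F] [Algebra K F] {x y : F}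
    (hy : Transcendental K y) (hxy : K⟮y, x⟯ = ⊤) {f : MvPolynomial (Fin 2) K} (hf : f ≠ 0)
    (hfxy : MvPolynomial.aeval ![x, y] f = 0) : Module.finrank K⟮y⟯ F ≤ f.totalDegree := by
  let φ : MvPolynomial (Fin 1) K →ₐ[K] K⟮y⟯ := MvPolynomial.aeval fun _ => AdjoinSimple.gen K y
  have hφ : Function.Injective φ := by
    refine algebraicIndependent_unique_type_iff.2 ?_
    rwa [← transcendental_algebraMap_iff (algebraMap K⟮y⟯ F).injective, AdjoinSimple.algebraMap_gen]
  let g : K⟮y⟯[X] := (MvPolynomial.finSuccEquiv K 1 f).map φ.toRingHom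
  have hg : g ≠ 0 :=
    (Polynomial.map_ne_zero_iff hφ).2 ((map_ne_zero_iff _ (AlgEquiv.injective _)).2 hf)
  have hcomp : ((Polynomial.aeval (R := K⟮y⟯) x).restrictScalars K).comp
      ((Polynomial.mapAlgHom φ).comp (MvPolynomial.finSuccEquiv K 1).toAlgHom) =
      MvPolynomial.aeval ![x, y] := by
    refine MvPolynomial.algHom_ext fun i => ?_
    refine Fin.cases ?_ (fun j => ?_) i
    · simp [MvPolynomial.finSuccEquiv_X_zero]
    · simp [MvPolynomial.finSuccEquiv_X_succ, φ]
  have hgx : Polynomial.aeval x g = 0 := (DFunLike.congr_fun hcomp f).trans hfxy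
  have hgdeg : g.natDegree ≤ f.totalDegree := by
    refine Polynomial.natDegree_map_le.trans ?_
    rw [MvPolynomial.natDegree_finSuccEquiv]
    exact MvPolynomial.degreeOf_le_totalDegree f 0
  have hint : IsIntegral K⟮y⟯ x := isAlgebraic_iff_isIntegral.1 ⟨g, hg, hgx⟩
  have htop : K⟮y⟯⟮x⟯ = ⊤ := by
    rw [← restrictScalars_eq_top_iff (K := K), adjoin_simple_adjoin_simple, hxy]
  rw [← finrank_top', ← htop, adjoin.finrank hint]
  exact (Polynomial.natDegree_le_natDegree (minpoly.degree_le_of_ne_zero _ _ hg hgx)).trans hgdeg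

variable {K : Type*} [Field K] {p q : K[X]} {u : RatFunc K}

theorem natDegree_le_natDegree_num (hpq : IsCoprime p q) (hp : p ≠ 0)
    (hu : u * algebraMap K[X] (RatFunc K) q = algebraMap K[X] (RatFunc K) p) :
    p.natDegree ≤ u.num.natDegree := by
  have hu0 : u ≠ 0 := by
    rintro rfl
    exact hp (by simpa using hu.symm)
  have hcross : u.num * q = p * u.denom := by
    refine RatFunc.algebraMap_injective K ?_
    have hnum : u * algebraMap K[X] (RatFunc K) u.denom = algebraMap K[X] (RatFunc K) u.num :=
      (eq_div_iff (RatFunc.algebraMap_ne_zero u.denom_ne_zero)).1 u.num_div_denom.symm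
    rw [map_mul, map_mul, ← hnum, ← hu]
    ring
  exact Polynomial.natDegree_le_of_dvd (hpq.dvd_of_dvd_mul_right ⟨_, hcross⟩)
    (RatFunc.num_ne_zero hu0)

theorem transcendental_of_isCoprime (hpq : IsCoprime p q) (hp : 0 < p.natDegree)
    (hu : u * algebraMap K[X] (RatFunc K) q = algebraMap K[X] (RatFunc K) p) :
    Transcendental K u := by
  refine u.transcendental_of_ne_C ?_
  rintro ⟨c, rfl⟩
  have := natDegree_le_natDegree_num hpq (Polynomial.ne_zero_of_natDegree_gt hp) hu
  rw [RatFunc.num_C, Polynomial.natDegree_C] at this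
  lia

theorem natDegree_le_totalDegree_of_adjoin_eq_top {v : RatFunc K} (hpq : IsCoprime p q)
    (hp : 0 < p.natDegree)
    (hu : u * algebraMap K[X] (RatFunc K) q = algebraMap K[X] (RatFunc K) p)
    (huv : K⟮u, v⟯ = ⊤) {f : MvPolynomial (Fin 2) K} (hf : f ≠ 0)
    (hfvu : MvPolynomial.aeval ![v, u] f = 0) : p.natDegree ≤ f.totalDegree := by
  have hdeg := natDegree_le_natDegree_num hpq (Polynomial.ne_zero_of_natDegree_gt hp) hu
  calc p.natDegree ≤ max u.num.natDegree u.denom.natDegree := le_max_of_le_left hdeg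
    _ = Module.finrank K⟮u⟯ (RatFunc K) := u.finrank_eq_max_natDegree.symm
    _ ≤ f.totalDegree :=
      finrank_adjoin_le_totalDegree (transcendental_of_isCoprime hpq hp hu) huv hf hfvu

end Birational

section PrimeIdeal

theorem exists_irreducible_eq_span_singleton {R : Type*} [CommRing R] [IsDomain R]
    [UniqueFactorizationMonoid R] (hdim : ringKrullDim R ≤ 2) {P : Ideal R} [hP : P.IsPrime]
    (hbot : P ≠ ⊥) (hmax : ¬ P.IsMaximal) : ∃ f, Irreducible f ∧ P = Ideal.span {f} := by
  obtain ⟨M, hM, hPM⟩ := P.exists_le_maximal hP.ne_top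
  have hlt : P < M := hPM.lt_of_ne fun h => hmax (h ▸ hM)
  have hM2 : M.height ≤ 2 :=
    WithBot.coe_le_coe.1 (Ideal.height_le_ringKrullDim_of_isPrime.trans hdim)
  have hheight : P.height = 1 := by
    refine le_antisymm ?_ (Order.one_le_iff_ne_zero.2 (mt Ideal.height_eq_zero_iff_eq_bot.1 hbot))
    exact (ENat.add_le_add_iff_right ENat.one_ne_top).1
      ((Ideal.height_add_one_le_of_lt_of_isPrime hlt).trans hM2)
  obtain ⟨f, hf, hfp⟩ := hP.exists_mem_prime_of_ne_bot hbot
  exact ⟨f, hfp.irreducible, P.eq_span_singleton_of_height_eq_one hheight hf hfp⟩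

end PrimeIdeal

section PartialDerivatives

open MvPolynomial

variable {σ R : Type*}

theorem add_single_mem_support_of_mem_support_pderiv [CommSemiring R] {i : σ}
    {f : MvPolynomial σ R} {m : σ →₀ ℕ} (hm : m ∈ (pderiv i f).support) :
    m + Finsupp.single i 1 ∈ f.support := by
  rw [mem_support_iff, coeff_pderiv] at hm
  exact mem_support_iff.2 (left_ne_zero_of_mul hm)

theorem totalDegree_pderiv_lt [CommSemiring R] {i : σ} {f : MvPolynomial σ R}
    (h : pderiv i f ≠ 0) : (pderiv i f).totalDegree < f.totalDegree := by
  have hlt : ∀ m ∈ (pderiv i f).support, (m.sum fun _ e => e) < f.totalDegree := fun m hm => by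
    have := le_totalDegree (add_single_mem_support_of_mem_support_pderiv hm)
    rw [Finsupp.sum_add_index' (fun _ => rfl) (fun _ _ _ => rfl),
      Finsupp.sum_single_index rfl] at this
    omega
  obtain ⟨m, hm⟩ := support_nonempty.2 h
  exact (Finset.sup_lt_iff ((Nat.zero_le _).trans_lt (hlt m hm))).2 hlt

theorem pderiv_eq_zero_of_dvd [CommRing R] [IsDomain R] {i : σ} {f : MvPolynomial σ R}
    (h : f ∣ pderiv i f) : pderiv i f = 0 := by
  by_contra h0
  exact (totalDegree_le_of_dvd_of_isDomain h h0).not_gt (totalDegree_pderiv_lt h0)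

theorem eq_C_of_pderiv_eq_zero [CommRing R] [IsDomain R] [CharZero R] {f : MvPolynomial σ R}
    (h : ∀ i, pderiv i f = 0) : f = C (coeff 0 f) := by
  classical
  ext m
  rw [coeff_C]
  split_ifs with hm
  · rw [hm]
  obtain ⟨i, hi⟩ : ∃ i, m i ≠ 0 := by
    by_contra! hcon
    exact hm (Finsupp.ext fun i => (hcon i).symm)
  have hle : Finsupp.single i 1 ≤ m := Finsupp.single_le_iff.2 (Nat.one_le_iff_ne_zero.2 hi)
  have hcoeff := congrArg (coeff (m - Finsupp.single i 1)) (h i)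
  rw [coeff_pderiv, coeff_zero, tsub_add_cancel_of_le hle] at hcoeff
  exact (mul_eq_zero.1 hcoeff).resolve_right (Nat.cast_add_one_ne_zero _)

theorem exists_not_dvd_pderiv [Field R] [CharZero R] {f : MvPolynomial σ R}
    (hf : Irreducible f) : ∃ i, ¬ f ∣ pderiv i f := by
  by_contra! h
  have hC := eq_C_of_pderiv_eq_zero fun i => pderiv_eq_zero_of_dvd (h i)
  have h0 : coeff 0 f ≠ 0 := fun h0 => hf.ne_zero (by rw [hC, h0, C_0])
  exact hf.not_isUnit (hC ▸ h0.isUnit.map C)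

theorem map_aeval_eq_sum_pderiv [Fintype σ] [CommRing R] {A : Type*} [CommRing A] [Algebra R A]
    (D : Derivation R A A) (v : σ → A) (f : MvPolynomial σ R) :
    D (aeval v f) = ∑ i, aeval v (pderiv i f) * D (v i) := by
  classical
  induction f using MvPolynomial.induction_on with
  | C a => simp
  | add p q hp hq => simp only [map_add, hp, hq, add_mul, Finset.sum_add_distrib]
  | mul_X p j hp =>
    simp only [map_mul, aeval_X, Derivation.leibniz, smul_eq_mul, hp, map_add, pderiv_X, add_mul,
      Finset.sum_add_distrib, Finset.mul_sum, Pi.single_apply]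
    congr 1
    · simp
    · exact Finset.sum_congr rfl fun i _ => by ring

end PartialDerivatives

section RealParts

open MvPolynomial

theorem exists_eq_map_add_C_I_mul_map {σ : Type*} (g : MvPolynomial σ ℂ) :
    ∃ g₁ g₂ : MvPolynomial σ ℝ, g₁.totalDegree ≤ g.totalDegree ∧
      g₂.totalDegree ≤ g.totalDegree ∧
      g = map (algebraMap ℝ ℂ) g₁ + C Complex.I * map (algebraMap ℝ ℂ) g₂ := by
  have hdeg (r : ℂ → ℝ) :
      (∑ m ∈ g.support, monomial m (r (coeff m g))).totalDegree ≤ g.totalDegree :=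
    (totalDegree_finsetSum _ _).trans <| Finset.sup_le fun m hm =>
      (totalDegree_monomial_le _ _).trans (le_totalDegree hm)
  refine ⟨∑ m ∈ g.support, monomial m (coeff m g).re, ∑ m ∈ g.support, monomial m (coeff m g).im,
    hdeg Complex.re, hdeg Complex.im, ?_⟩
  conv_lhs => rw [← support_sum_monomial_coeff g]
  simp only [map_sum, map_monomial, Finset.mul_sum, C_mul_monomial, ← Finset.sum_add_distrib,
    ← map_add]
  refine Finset.sum_congr rfl fun m _ => congrArg _ ?_
  rw [mul_comm]
  exact (Complex.re_add_im _).symm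

end RealParts

section CircleUnit

open LaurentPolynomial

/-- The point `e^{iθ}` as a unit of `ℂ`. -/
noncomputable def circleUnit (θ : ℝ) : ℂˣ :=
  Circle.toUnits (Circle.exp θ)

theorem coe_circleUnit (θ : ℝ) : (circleUnit θ : ℂ) = Complex.exp (θ * Complex.I) :=
  Circle.coe_exp θ

theorem injOn_circleUnit : Set.InjOn circleUnit (Set.Ioc (-Real.pi) Real.pi) := by
  intro s hs θ hθ h
  rw [Units.ext_iff, coe_circleUnit, coe_circleUnit, ← Circle.coe_exp, ← Circle.coe_exp] at h
  rw [← Circle.arg_exp hs.1 hs.2, ← Circle.arg_exp hθ.1 hθ.2, h]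

theorem exists_circleUnit_eq_neg (θ : ℝ) :
    ∃ φ ∈ Set.Ioc (-Real.pi) Real.pi, circleUnit φ = -circleUnit θ := by
  refine ⟨(-Circle.exp θ : Circle).1.arg, Complex.arg_mem_Ioc _, Units.ext ?_⟩
  rw [circleUnit, Circle.exp_arg]
  rfl

theorem eq_zero_of_forall_circleUnit {P : ℂ[T;T⁻¹]}
    (h : ∀ θ, laurentAeval (circleUnit θ) P = 0) : P = 0 := by
  by_contra hP
  refine (Set.Ioc_infinite (neg_lt_self Real.pi_pos)).image injOn_circleUnit ?_
  exact (finite_setOf_laurentAeval_eq_zero hP).subset (Set.image_subset_iff.2 fun θ _ => h θ)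

end CircleUnit

section LaurentParam

open MvPolynomial

/-- The curve `γ` is given by the Laurent polynomials `v i` in `e^{iθ}`. -/
def IsLaurentParam {σ : Type*} (γ : ℝ → σ → ℝ) (v : σ → ℂ[T;T⁻¹]) : Prop :=
  ∀ θ i, (γ θ i : ℂ) = laurentAeval (circleUnit θ) (v i)

namespace IsLaurentParam

variable {σ : Type*} {γ : ℝ → σ → ℝ} {v : σ → ℂ[T;T⁻¹]}

theorem laurentAeval_aeval (h : IsLaurentParam γ v) (f : MvPolynomial σ ℝ) (θ : ℝ) :
    laurentAeval (circleUnit θ) (aeval v f) = (aeval (γ θ) f : ℝ) := by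
  have hcomp : ((laurentAeval (circleUnit θ)).restrictScalars ℝ).comp (aeval v) =
      Complex.ofRealAm.comp (aeval (γ θ)) :=
    algHom_ext fun i => by simpa using (h θ i).symm
  exact DFunLike.congr_fun hcomp f

theorem mem_vanishingIdeal_iff (h : IsLaurentParam γ v) {f : MvPolynomial σ ℝ} :
    f ∈ vanishingIdeal ℝ (Set.range γ) ↔ aeval v f = 0 := by
  rw [MvPolynomial.mem_vanishingIdeal_iff, Set.forall_mem_range]
  refine ⟨fun hf => eq_zero_of_forall_circleUnit fun θ => ?_, fun hf θ => ?_⟩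
  · rw [h.laurentAeval_aeval, hf, Complex.ofReal_zero]
  · rw [← Complex.ofReal_eq_zero, ← h.laurentAeval_aeval, hf, map_zero]

theorem isPrime_vanishingIdeal (h : IsLaurentParam γ v) :
    (vanishingIdeal ℝ (Set.range γ)).IsPrime := by
  have hker : vanishingIdeal ℝ (Set.range γ) = RingHom.ker (aeval v : _ →ₐ[ℝ] ℂ[T;T⁻¹]) :=
    Ideal.ext fun f => h.mem_vanishingIdeal_iff
  exact hker ▸ RingHom.ker_isPrime _

theorem aeval_eq_zero_of_add_C_I_mul (h : IsLaurentParam γ v) {f g : MvPolynomial σ ℝ}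
    (hfg : aeval v (map (algebraMap ℝ ℂ) f + C Complex.I * map (algebraMap ℝ ℂ) g) = 0) :
    aeval v f = 0 ∧ aeval v g = 0 := by
  have hre (θ : ℝ) : aeval (γ θ) f = 0 ∧ aeval (γ θ) g = 0 := by
    have := congrArg (laurentAeval (circleUnit θ)) hfg
    simp only [map_add, map_mul, aeval_map_algebraMap, h.laurentAeval_aeval, map_zero, aeval_C,
      AlgHom.commutes, Complex.ext_iff] at this
    simpa using this
  simp only [← h.mem_vanishingIdeal_iff, MvPolynomial.mem_vanishingIdeal_iff, Set.forall_mem_range]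
  exact ⟨fun θ => (hre θ).1, fun θ => (hre θ).2⟩

theorem exists_aeval_eq_zero_real (h : IsLaurentParam γ v) {g : MvPolynomial σ ℂ} (hg : g ≠ 0)
    (hgv : aeval v g = 0) :
    ∃ f : MvPolynomial σ ℝ, f ≠ 0 ∧ f.totalDegree ≤ g.totalDegree ∧ aeval v f = 0 := by
  obtain ⟨g₁, g₂, hdeg₁, hdeg₂, rfl⟩ := exists_eq_map_add_C_I_mul_map g
  obtain ⟨hg₁, hg₂⟩ := h.aeval_eq_zero_of_add_C_I_mul hgv
  obtain rfl | hne := eq_or_ne g₁ 0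
  · exact ⟨g₂, fun h₂ => hg (by rw [h₂]; simp), hdeg₂, hg₂⟩
  · exact ⟨g₁, hne, hdeg₁, hg₁⟩

theorem image_Icc_eq_range (h : IsLaurentParam γ v) :
    γ '' Set.Icc (-Real.pi) Real.pi = Set.range γ := by
  have hper : Function.Periodic γ (2 * Real.pi) := fun θ => by
    funext i
    rw [← Complex.ofReal_inj, h, h, circleUnit, Circle.periodic_exp, circleUnit]
  convert hper.image_Icc Real.two_pi_pos (-Real.pi) using 2
  ring_nf

end IsLaurentParam

end LaurentParam

section FunctionField

open LaurentPolynomial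

variable {K : Type*} [Field K]

/-- The embedding of the Laurent polynomials into the rational functions. -/
noncomputable def laurentToRatFunc : K[T;T⁻¹] →ₐ[K] RatFunc K :=
  laurentAeval (Units.mk0 RatFunc.X RatFunc.X_ne_zero)

theorem laurentToRatFunc_T_natCast (n : ℕ) :
    laurentToRatFunc (T n : K[T;T⁻¹]) = RatFunc.X ^ n := by
  simp [laurentToRatFunc]

theorem laurentToRatFunc_toLaurent (p : K[X]) :
    laurentToRatFunc (Polynomial.toLaurent p) = algebraMap K[X] (RatFunc K) p := by
  simp [laurentToRatFunc]

theorem laurentToRatFunc_injective : Function.Injective (laurentToRatFunc (K := K)) :=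
  laurentAeval_injective RatFunc.transcendental_X

variable {σ : Type*}

/-- The subfield of `K(T)` generated over `K` by a family of Laurent polynomials. -/
noncomputable def laurentField (v : σ → K[T;T⁻¹]) : IntermediateField K (RatFunc K) :=
  IntermediateField.adjoin K (Set.range fun i => laurentToRatFunc (v i))

variable {v : σ → K[T;T⁻¹]}

theorem laurentToRatFunc_mem_laurentField (i : σ) : laurentToRatFunc (v i) ∈ laurentField v :=
  IntermediateField.subset_adjoin K _ ⟨i, rfl⟩

theorem laurentToRatFunc_aeval_mem_laurentField (g : MvPolynomial σ K) :
    laurentToRatFunc (MvPolynomial.aeval v g) ∈ laurentField v := by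
  induction g using MvPolynomial.induction_on with
  | C a =>
    rw [MvPolynomial.algHom_C, AlgHom.commutes]
    exact (laurentField v).algebraMap_mem a
  | add p q hp hq => simpa only [map_add] using add_mem hp hq
  | mul_X p i hp =>
    simpa only [map_mul, MvPolynomial.aeval_X] using
      mul_mem hp (laurentToRatFunc_mem_laurentField i)

/-- `P` is a quotient of polynomials in the `v i`, with nonzero denominator. -/
def IsRationalIn (v : σ → K[T;T⁻¹]) (P : K[T;T⁻¹]) : Prop :=
  ∃ g₁ g₂ : MvPolynomial σ K,
    MvPolynomial.aeval v g₁ ≠ 0 ∧ P * MvPolynomial.aeval v g₁ = MvPolynomial.aeval v g₂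

theorem IsRationalIn.X_pow_mem_laurentField {n : ℕ} (h : IsRationalIn v (T n)) :
    RatFunc.X ^ n ∈ laurentField v := by
  obtain ⟨g₁, g₂, hg₁, hg⟩ := h
  have hg₁' := (map_ne_zero_iff _ laurentToRatFunc_injective).2 hg₁
  rw [← laurentToRatFunc_T_natCast, ← mul_div_cancel_right₀ (laurentToRatFunc (T n)) hg₁',
    ← map_mul, hg]
  exact div_mem (laurentToRatFunc_aeval_mem_laurentField g₂)
    (laurentToRatFunc_aeval_mem_laurentField g₁)

theorem IsRationalIn.of_substSq {P : K[T;T⁻¹]}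
    (h : IsRationalIn (fun i => substSq (v i)) (substSq P)) : IsRationalIn v P := by
  obtain ⟨g₁, g₂, hg₁, hg⟩ := h
  simp only [← MvPolynomial.comp_aeval_apply, ← map_mul] at hg₁ hg
  exact ⟨g₁, g₂, fun h0 => hg₁ (by rw [h0, map_zero]), substSq_injective hg⟩

theorem X_mem_laurentField_of_notMem_range_substSq (hX : RatFunc.X ^ 2 ∈ laurentField v) {i : σ}
    (hi : v i ∉ Set.range substSq) : RatFunc.X ∈ laurentField v := by
  obtain ⟨E, O, hEO⟩ := exists_eq_substSq_add (v i)
  have hO : O ≠ 0 := fun h0 => hi ⟨E, by rw [hEO, h0, map_zero, mul_zero, add_zero]⟩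
  have hmem (P : K[T;T⁻¹]) : laurentToRatFunc (substSq P) ∈ laurentField v := by
    rw [laurentToRatFunc, laurentAeval_substSq]
    exact laurentAeval_mem _ hX P
  have hO' : laurentToRatFunc (substSq O) ≠ 0 := by
    rwa [map_ne_zero_iff _ laurentToRatFunc_injective, map_ne_zero_iff _ substSq_injective]
  have hdiv : RatFunc.X = (laurentToRatFunc (v i) - laurentToRatFunc (substSq E)) /
      laurentToRatFunc (substSq O) := by
    rw [eq_div_iff hO', hEO, map_add, add_sub_cancel_left, map_mul, ← Nat.cast_one,
      laurentToRatFunc_T_natCast, pow_one]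
  rw [hdiv]
  exact div_mem (sub_mem (laurentToRatFunc_mem_laurentField i) (hmem E)) (hmem O)

end FunctionField

section PlaneCurve

open LaurentPolynomial

variable {K : Type*} [Field K] {v : Fin 2 → K[T;T⁻¹]} {n : ℕ}

/-- The plane curve parametrized by `v` has poles of order at most `n` at `0` and `∞`, and its
second coordinate has poles of order exactly `n` there. -/
structure HasPoleOrder (v : Fin 2 → K[T;T⁻¹]) (n : ℕ) : Prop where
  coeff_eq_zero : ∀ i (k : ℤ), n < k.natAbs → (v i).coeff k = 0
  coeff_ne_zero : (v 1).coeff n ≠ 0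
  coeff_neg_ne_zero : (v 1).coeff (-n) ≠ 0

namespace HasPoleOrder

theorem exists_isCoprime (hv : HasPoleOrder v n) :
    ∃ p : K[X], Polynomial.toLaurent p = T n * v 1 ∧ p.natDegree = 2 * n ∧
      IsCoprime p (Polynomial.X ^ n) := by
  obtain ⟨p, hp, hdeg, hp0, hpn⟩ := exists_toLaurent_eq_T_mul (hv.coeff_eq_zero 1)
  refine ⟨p, hp, ?_, ?_⟩
  · exact hdeg.antisymm (Polynomial.le_natDegree_of_ne_zero (hpn ▸ hv.coeff_ne_zero))
  · refine (((Polynomial.irreducible_X).coprime_iff_not_dvd.2 ?_).symm).pow_right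
    rw [Polynomial.X_dvd_iff, hp0]
    exact hv.coeff_neg_ne_zero

theorem exists_aeval_eq_zero (hv : HasPoleOrder v n) (hn : n ≠ 0) :
    ∃ g : MvPolynomial (Fin 2) K, g ≠ 0 ∧ g.totalDegree ≤ 2 * n ∧ MvPolynomial.aeval v g = 0 := by
  obtain ⟨p, hp, hdeg, hcop⟩ := hv.exists_isCoprime
  obtain ⟨q, hq, hqdeg, -⟩ := exists_toLaurent_eq_T_mul (hv.coeff_eq_zero 0)
  have haeval (p : K[X]) : Polynomial.aeval (T 1 : K[T;T⁻¹]) p = Polynomial.toLaurent p := by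
    rw [← Polynomial.toLaurent_X, ← Polynomial.toLaurentAlg_apply, Polynomial.aeval_algHom_apply,
      Polynomial.aeval_X_left_apply, Polynomial.toLaurentAlg_apply]
  have hX : Polynomial.aeval (T 1 : K[T;T⁻¹]) (Polynomial.X ^ n : K[X]) = T n := by
    rw [haeval, Polynomial.toLaurent_X_pow]
  obtain ⟨g, hg0, hgdeg, hg⟩ := exists_aeval_eq_zero_totalDegree_le (A := K[T;T⁻¹]) (t := T 1)
    (x := v 0) (y := v 1) (q := q) hcop (by lia) (by lia) (by simp; lia)
    (hX ▸ (isUnit_T n).ne_zero) (by rw [hX, haeval, hq, mul_comm])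
    (by rw [hX, haeval, hp, mul_comm])
  exact ⟨g, hg0, hdeg ▸ hgdeg, FinVec.etaExpand_eq v ▸ hg⟩

theorem le_totalDegree (hv : HasPoleOrder v n) (hn : n ≠ 0) (hX : RatFunc.X ∈ laurentField v)
    {f : MvPolynomial (Fin 2) K} (hf : f ≠ 0) (hfv : MvPolynomial.aeval v f = 0) :
    2 * n ≤ f.totalDegree := by
  obtain ⟨p, hp, hdeg, hcop⟩ := hv.exists_isCoprime
  have htop : IntermediateField.adjoin K {laurentToRatFunc (v 1), laurentToRatFunc (v 0)} = ⊤ := by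
    rw [Set.pair_comm, ← top_le_iff, ← RatFunc.adjoin_X, IntermediateField.adjoin_simple_le_iff]
    convert hX using 2
    rw [laurentField]
    congr 1
    ext z
    simp [Fin.exists_fin_two, eq_comm]
  rw [← hdeg]
  refine natDegree_le_totalDegree_of_adjoin_eq_top hcop (by lia) ?_ htop hf ?_
  · rw [← laurentToRatFunc_toLaurent, ← laurentToRatFunc_toLaurent, hp, Polynomial.toLaurent_X_pow,
      ← map_mul, mul_comm]
  · have hvec : ![laurentToRatFunc (v 0), laurentToRatFunc (v 1)] =
        fun i => laurentToRatFunc (v i) :=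
      FinVec.etaExpand_eq fun i => laurentToRatFunc (v i)
    rw [hvec, ← MvPolynomial.comp_aeval_apply, hfv, map_zero]

end HasPoleOrder

end PlaneCurve

section DefiningPolynomial

open MvPolynomial
open LaurentPolynomial (T)

theorem not_isMaximal_vanishingIdeal {K σ : Type*} [Field K] {S : Set (σ → K)} (hS : S.Nontrivial) :
    ¬ (vanishingIdeal K S : Ideal (MvPolynomial σ K)).IsMaximal := by
  intro hmax
  obtain ⟨x, hx, y, hy, hxy⟩ := hS
  have heq : vanishingIdeal K S = (vanishingIdeal K {x} : Ideal (MvPolynomial σ K)) :=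
    hmax.eq_of_le (inferInstance : (vanishingIdeal K {x}).IsPrime).ne_top
      (vanishingIdeal_anti_mono (Set.singleton_subset_iff.2 hx))
  refine hxy (funext fun i => ?_)
  have hmem : X i - C (x i) ∈ vanishingIdeal K S := by
    rw [heq, mem_vanishingIdeal_singleton_iff]
    simp
  have := mem_vanishingIdeal_iff.1 hmem y hy
  rw [map_sub, aeval_X, aeval_C, sub_eq_zero] at this
  exact this.symm

theorem exists_isDefiningPolynomial_of_isPrime {S : Set (Fin 2 → ℝ)} (hS : S.Nontrivial)
    (hprime : (vanishingIdeal ℝ S : Ideal (MvPolynomial (Fin 2) ℝ)).IsPrime)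
    (hbot : (vanishingIdeal ℝ S : Ideal (MvPolynomial (Fin 2) ℝ)) ≠ ⊥) :
    ∃ f, IsDefiningPolynomial S f := by
  refine exists_irreducible_eq_span_singleton ?_ hbot (not_isMaximal_vanishingIdeal hS)
  simp [ringKrullDim_of_isNoetherianRing, ringKrullDim_eq_zero_of_field]

namespace IsLaurentParam

variable {γ : ℝ → Fin 2 → ℝ} {v : Fin 2 → ℂ[T;T⁻¹]} {f : MvPolynomial (Fin 2) ℝ} {n : ℕ}

theorem aeval_eq_zero_iff_dvd (h : IsLaurentParam γ v)
    (hf : IsDefiningPolynomial (Set.range γ) f) {g : MvPolynomial (Fin 2) ℝ} :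
    aeval v g = 0 ↔ f ∣ g := by
  rw [← h.mem_vanishingIdeal_iff, hf.2, Ideal.mem_span_singleton]

theorem nontrivial_range (h : IsLaurentParam γ v) (hv : HasPoleOrder v n) (hn : n ≠ 0) :
    (Set.range γ).Nontrivial := by
  by_contra hsub
  rw [Set.not_nontrivial_iff] at hsub
  have hconst : v 1 = LaurentPolynomial.C ↑(γ 0 1) := by
    rw [← sub_eq_zero]
    refine eq_zero_of_forall_circleUnit fun θ => ?_
    rw [map_sub, laurentAeval_C, ← h, hsub ⟨θ, rfl⟩ ⟨0, rfl⟩]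
    exact sub_self _
  refine hv.coeff_ne_zero ?_
  rw [hconst, ← LaurentPolynomial.single_eq_C, AddMonoidAlgebra.coeff_single,
    Finsupp.single_eq_of_ne (Nat.cast_ne_zero.2 hn)]

theorem exists_isDefiningPolynomial (h : IsLaurentParam γ v) (hv : HasPoleOrder v n)
    (hn : n ≠ 0) : ∃ f, IsDefiningPolynomial (Set.range γ) f := by
  obtain ⟨g, hg, -, hgv⟩ := hv.exists_aeval_eq_zero hn
  obtain ⟨f, hf, -, hfv⟩ := h.exists_aeval_eq_zero_real hg hgv
  exact exists_isDefiningPolynomial_of_isPrime (h.nontrivial_range hv hn) h.isPrime_vanishingIdeal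
    (Submodule.ne_bot_iff _ |>.2 ⟨f, h.mem_vanishingIdeal_iff.2 hfv, hf⟩)

theorem totalDegree_eq (h : IsLaurentParam γ v) (hv : HasPoleOrder v n) (hn : n ≠ 0)
    (hX : RatFunc.X ∈ laurentField v) (hf : IsDefiningPolynomial (Set.range γ) f) :
    f.totalDegree = 2 * n := by
  apply le_antisymm
  · obtain ⟨g, hg, hgdeg, hgv⟩ := hv.exists_aeval_eq_zero hn
    obtain ⟨f', hf', hdeg, hfv⟩ := h.exists_aeval_eq_zero_real hg hgv
    exact (totalDegree_le_of_dvd_of_isDomain ((h.aeval_eq_zero_iff_dvd hf).1 hfv) hf').trans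
      (hdeg.trans hgdeg)
  · have hmap : map (algebraMap ℝ ℂ) f ≠ 0 :=
      (map_ne_zero_iff _ (map_injective _ (algebraMap ℝ ℂ).injective)).2 hf.1.ne_zero
    have hroot : aeval v (map (algebraMap ℝ ℂ) f) = 0 := by
      rw [aeval_map_algebraMap, h.aeval_eq_zero_iff_dvd hf]
    exact (hv.le_totalDegree hn hX hmap hroot).trans (Finset.sup_mono (support_map_subset _ _))

theorem isRationalIn_T_two (h : IsLaurentParam γ v)
    (hf : IsDefiningPolynomial (Set.range γ) f) {Q : ℂ[T;T⁻¹]} (hQ : Q ≠ 0)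
    (h₀ : eulerDerivation (v 0) = (T 2 - 1) * Q)
    (h₁ : eulerDerivation (v 1) = -LaurentPolynomial.C Complex.I * (T 2 + 1) * Q) :
    IsRationalIn v (T 2) := by
  let F := map (algebraMap ℝ ℂ) f
  have hF : aeval v F = 0 := by rw [aeval_map_algebraMap, h.aeval_eq_zero_iff_dvd hf]
  have hchain := map_aeval_eq_sum_pderiv eulerDerivation v F
  rw [hF, map_zero, Fin.sum_univ_two, h₀, h₁] at hchain
  refine ⟨pderiv 0 F - C Complex.I * pderiv 1 F, pderiv 0 F + C Complex.I * pderiv 1 F,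
    fun h0 => ?_, ?_⟩
  · have hsum : pderiv 0 F - C Complex.I * pderiv 1 F = map (algebraMap ℝ ℂ) (pderiv 0 f) +
        C Complex.I * map (algebraMap ℝ ℂ) (-pderiv 1 f) := by
      simp only [F, pderiv_map, map_neg]
      ring
    obtain ⟨hx, hy⟩ := h.aeval_eq_zero_of_add_C_I_mul (hsum ▸ h0)
    rw [map_neg, neg_eq_zero] at hy
    obtain ⟨i, hi⟩ := exists_not_dvd_pderiv hf.1
    fin_cases i
    · exact hi ((h.aeval_eq_zero_iff_dvd hf).1 hx)
    · exact hi ((h.aeval_eq_zero_iff_dvd hf).1 hy)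
  · refine mul_right_cancel₀ hQ ?_
    simp only [map_sub, map_add, map_mul, algHom_C, LaurentPolynomial.algebraMap_apply]
    linear_combination -hchain

theorem totalDegree_eq_of_notMem_range_substSq (h : IsLaurentParam γ v) (hv : HasPoleOrder v n)
    (hn : n ≠ 0) (hf : IsDefiningPolynomial (Set.range γ) f) (hT : IsRationalIn v (T 2)) {i : Fin 2}
    (hi : v i ∉ Set.range substSq) : f.totalDegree = 2 * n :=
  h.totalDegree_eq hv hn
    (X_mem_laurentField_of_notMem_range_substSq (hT.X_pow_mem_laurentField (n := 2)) hi) hf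

theorem comp_half {w : Fin 2 → ℂ[T;T⁻¹]} (h : IsLaurentParam γ fun i => substSq (w i)) :
    IsLaurentParam (fun φ => γ (φ / 2)) w := fun φ i => by
  rw [h, laurentAeval_substSq]
  congr 2
  rw [circleUnit, circleUnit, ← map_pow, ← Circle.exp_nsmul]
  simp [mul_div_cancel₀]

theorem totalDegree_eq_of_substSq {w : Fin 2 → ℂ[T;T⁻¹]}
    (h : IsLaurentParam γ fun i => substSq (w i)) (hw : HasPoleOrder w n) (hn : n ≠ 0)
    (hf : IsDefiningPolynomial (Set.range γ) f) (hT : IsRationalIn (fun i => substSq (w i)) (T 2)) :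
    f.totalDegree = 2 * n := by
  have hrange : Set.range (fun φ => γ (φ / 2)) = Set.range γ :=
    (Equiv.divRight₀ 2 two_ne_zero).surjective.range_comp γ
  rw [← mul_one (2 : ℤ), ← substSq_T] at hT
  refine h.comp_half.totalDegree_eq hw hn ?_ (hrange ▸ hf)
  exact pow_one (RatFunc.X (K := ℂ)) ▸ (hT.of_substSq.X_pow_mem_laurentField (n := 1))

theorem eq_iff_circleUnit_eq_or_eq_neg (h : IsLaurentParam γ v)
    (hv : ∀ i, v i ∈ Set.range substSq) {g₁ g₂ : MvPolynomial (Fin 2) ℂ}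
    (hg : T 2 * aeval v g₁ = aeval v g₂) {s θ : ℝ}
    (hθ : laurentAeval (circleUnit θ) (aeval v g₁) ≠ 0) :
    γ s = γ θ ↔ circleUnit s = circleUnit θ ∨ circleUnit s = -circleUnit θ := by
  have hsq : circleUnit s ^ 2 = circleUnit θ ^ 2 ↔
      circleUnit s = circleUnit θ ∨ circleUnit s = -circleUnit θ := by
    simp only [Units.ext_iff, Units.val_pow_eq_pow_val, Units.val_neg, sq_eq_sq_iff_eq_or_eq_neg]
  rw [← hsq]
  constructor <;> intro hst
  · have heval (g : MvPolynomial (Fin 2) ℂ) :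
        laurentAeval (circleUnit s) (aeval v g) = laurentAeval (circleUnit θ) (aeval v g) := by
      simp only [comp_aeval_apply, ← h _ _, hst]
    have htwo (φ : ℝ) := congrArg (laurentAeval (circleUnit φ)) hg
    simp only [map_mul, laurentAeval_T] at htwo
    have := htwo s
    rw [heval, heval, ← htwo θ] at this
    exact Units.ext (mul_right_cancel₀ hθ this)
  · funext i
    obtain ⟨w, hw⟩ := hv i
    rw [← Complex.ofReal_inj, h, h, ← hw, laurentAeval_substSq, laurentAeval_substSq, hst]

theorem tracesTimes_two (h : IsLaurentParam γ v) (hv : ∀ i, v i ∈ Set.range substSq)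
    (hT : IsRationalIn v (T 2)) : TracesTimes γ 2 := by
  obtain ⟨g₁, g₂, hg₁, hg⟩ := hT
  refine Set.Finite.of_injOn (f := circleUnit) (t := {u | laurentAeval u (aeval v g₁) = 0})
    (fun θ hθ => ?_) (injOn_circleUnit.mono fun θ hθ => hθ.1)
    (finite_setOf_laurentAeval_eq_zero hg₁)
  by_contra hne
  refine hθ.2 ?_
  obtain ⟨φ, hφ, hφθ⟩ := exists_circleUnit_eq_neg θ
  have hfiber : {s ∈ Set.Ioc (-Real.pi) Real.pi | γ s = γ θ} = {θ, φ} := by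
    ext s
    simp only [Set.mem_ofPred_eq, h.eq_iff_circleUnit_eq_or_eq_neg hv hg hne, ← hφθ]
    constructor
    · rintro ⟨hs, hsθ | hsφ⟩
      · exact Or.inl (injOn_circleUnit hs hθ.1 hsθ)
      · exact Or.inr (injOn_circleUnit hs hφ hsφ)
    · rintro (rfl | rfl)
      · exact ⟨hθ.1, Or.inl rfl⟩
      · exact ⟨hφ, Or.inr rfl⟩
  rw [hfiber, Set.ncard_pair]
  rintro rfl
  exact self_ne_neg.2 (Units.ne_zero _) (congrArg Units.val hφθ)

end IsLaurentParam

end DefiningPolynomial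

section SupportCurve

open LaurentPolynomial

theorem laurentAeval_circleUnit_T (θ : ℝ) (k : ℤ) :
    laurentAeval (circleUnit θ) (T k : ℂ[T;T⁻¹]) =
      Complex.cos (k * θ) + Complex.sin (k * θ) * Complex.I := by
  rw [laurentAeval_T, Units.val_zpow_eq_zpow_val, coe_circleUnit, ← Complex.exp_int_mul,
    ← mul_assoc, Complex.exp_mul_I]

theorem eulerDerivation_C_mul (r : ℂ) (Q : ℂ[T;T⁻¹]) :
    eulerDerivation (C r * Q) = C r * eulerDerivation Q := by
  rw [← smul_eq_C_mul, Derivation.map_smul, smul_eq_C_mul]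

theorem eulerDerivation_T_mul (k : ℤ) (Q : ℂ[T;T⁻¹]) :
    eulerDerivation (T k * Q) = T k * (C (k : ℂ) * Q + eulerDerivation Q) := by
  rw [Derivation.leibniz, eulerDerivation_T, smul_eq_mul, smul_eq_mul]
  ring

theorem hasDerivAt_laurentAeval_circleUnit (P : ℂ[T;T⁻¹]) (θ : ℝ) :
    HasDerivAt (fun θ => laurentAeval (circleUnit θ) P)
      (Complex.I * laurentAeval (circleUnit θ) (eulerDerivation P)) θ := by
  induction P using LaurentPolynomial.induction_on' with
  | add P Q hP hQ =>
    simp only [map_add, mul_add]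
    exact hP.add hQ
  | C_mul_T n r =>
    have hexp : HasDerivAt (fun θ : ℝ => Complex.exp (n * (θ * Complex.I)))
        (Complex.exp (n * (θ * Complex.I)) * (n * (1 * Complex.I))) θ :=
      (((hasDerivAt_id θ).ofReal_comp.mul_const Complex.I).const_mul (n : ℂ)).cexp
    have hT (φ : ℝ) : ((circleUnit φ ^ n : ℂˣ) : ℂ) = Complex.exp (n * (φ * Complex.I)) := by
      rw [Units.val_zpow_eq_zpow_val, coe_circleUnit, Complex.exp_int_mul]
    simp only [eulerDerivation_C_mul, eulerDerivation_T, map_mul, laurentAeval_T, laurentAeval_C,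
      Algebra.algebraMap_self, RingHom.id_apply, hT]
    refine (hexp.const_mul r).congr_deriv ?_
    ring

variable {p : ℝ → ℝ} {P : ℂ[T;T⁻¹]} {N : ℕ}

theorem ofReal_deriv_eq (hp : ∀ θ, (p θ : ℂ) = laurentAeval (circleUnit θ) P) (θ : ℝ) :
    ((deriv p θ : ℝ) : ℂ) = Complex.I * laurentAeval (circleUnit θ) (eulerDerivation P) := by
  have hderiv := hasDerivAt_laurentAeval_circleUnit P θ
  simp only [← hp] at hderiv
  have hreal : HasDerivAt p _ θ := Complex.reCLM.hasFDerivAt.comp_hasDerivAt θ hderiv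
  exact hreal.differentiableAt.hasDerivAt.ofReal_comp.unique hderiv

/-- The coordinates of `supportParam p` as Laurent polynomials in `T = e^{iθ}`, for a support
function `p` given by the Laurent polynomial `P`. -/
noncomputable def supportLaurent (P : ℂ[T;T⁻¹]) : Fin 2 → ℂ[T;T⁻¹] :=
  ![C (1 / 2) * (T 1 * (P - eulerDerivation P) + T (-1) * (P + eulerDerivation P)),
    C (-Complex.I / 2) * (T 1 * (P - eulerDerivation P) - T (-1) * (P + eulerDerivation P))]

theorem isLaurentParam_supportParam (hp : ∀ θ, (p θ : ℂ) = laurentAeval (circleUnit θ) P) :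
    IsLaurentParam (supportParam p) (supportLaurent P) := fun θ i => by
  have hT : laurentAeval (circleUnit θ) (T 1 : ℂ[T;T⁻¹]) =
      Complex.cos θ + Complex.sin θ * Complex.I := by
    simpa using laurentAeval_circleUnit_T θ 1
  have hTinv : laurentAeval (circleUnit θ) (T (-1) : ℂ[T;T⁻¹]) =
      Complex.cos θ - Complex.sin θ * Complex.I := by
    simpa [sub_eq_add_neg] using laurentAeval_circleUnit_T θ (-1)
  fin_cases i <;>
  simp only [supportParam, supportLaurent, Fin.zero_eta, Fin.mk_one, Matrix.cons_val_zero,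
    Matrix.cons_val_one, map_mul, map_add, map_sub, laurentAeval_C, Algebra.algebraMap_self,
    RingHom.id_apply, Complex.ofReal_sub, Complex.ofReal_add, Complex.ofReal_mul,
    Complex.ofReal_cos, Complex.ofReal_sin, hp, ofReal_deriv_eq hp, hT, hTinv]
  · ring
  · linear_combination laurentAeval (circleUnit θ) P * Complex.sin θ * Complex.I_sq

theorem supportCurve_eq_range (hp : ∀ θ, (p θ : ℂ) = laurentAeval (circleUnit θ) P) :
    supportCurve p = Set.range (supportParam p) :=
  (isLaurentParam_supportParam hp).image_Icc_eq_range

theorem coeff_supportLaurent_zero (P : ℂ[T;T⁻¹]) (k : ℤ) :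
    (supportLaurent P 0).coeff k =
      1 / 2 * ((2 - k) * P.coeff (k - 1) + (2 + k) * P.coeff (k + 1)) := by
  simp only [supportLaurent, Matrix.cons_val_zero, coeff_C_mul, AddMonoidAlgebra.coeff_add,
    AddMonoidAlgebra.coeff_sub, Finsupp.add_apply, Finsupp.sub_apply, coeff_T_mul,
    coeff_eulerDerivation, sub_neg_eq_add, Int.cast_sub, Int.cast_add, Int.cast_one]
  ring

theorem coeff_supportLaurent_one (P : ℂ[T;T⁻¹]) (k : ℤ) :
    (supportLaurent P 1).coeff k =
      -Complex.I / 2 * ((2 - k) * P.coeff (k - 1) - (2 + k) * P.coeff (k + 1)) := by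
  simp only [supportLaurent, Matrix.cons_val_one, Matrix.cons_val_zero, coeff_C_mul,
    AddMonoidAlgebra.coeff_add, AddMonoidAlgebra.coeff_sub, Finsupp.add_apply, Finsupp.sub_apply,
    coeff_T_mul, coeff_eulerDerivation, sub_neg_eq_add, Int.cast_sub, Int.cast_add, Int.cast_one]
  ring

theorem forall_supportLaurent_mem_range_substSq_iff :
    (∀ i, supportLaurent P i ∈ Set.range substSq) ↔ ∀ k, Even k → P.coeff k = 0 := by
  simp only [mem_range_substSq_iff, Fin.forall_fin_two, coeff_supportLaurent_zero,
    coeff_supportLaurent_one]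
  constructor
  · rintro ⟨h₀, h₁⟩ k hk
    have hk1 : (1 - k : ℂ) ≠ 0 := by
      rw [sub_ne_zero]
      rintro h
      exact Int.not_even_one ((Int.cast_eq_one.1 h.symm : k = 1) ▸ hk)
    have hx := h₀ (k + 1) hk.add_one
    have hy := h₁ (k + 1) hk.add_one
    rw [add_sub_cancel_right, Int.cast_add, Int.cast_one] at hx hy
    refine (mul_eq_zero.1 ?_).resolve_left hk1
    linear_combination hx + Complex.I * hy +
      1 / 2 * ((1 - k) * P.coeff k - (3 + k) * P.coeff (k + 1 + 1)) * Complex.I_sq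
  · intro h
    have hzero (k : ℤ) (hk : Odd k) : P.coeff (k - 1) = 0 ∧ P.coeff (k + 1) = 0 :=
      ⟨h _ (hk.sub_odd odd_one), h _ hk.add_one⟩
    constructor <;> intro k hk <;> simp [hzero k hk]

/-- The Laurent polynomial of `(p + p'') / (2 e^{iθ})`. Since the derivative of `supportParam p` is
`(p + p'') (-sin θ, cos θ)`, this is the common factor of the derivatives of the coordinates. -/
noncomputable def tangentFactor (P : ℂ[T;T⁻¹]) : ℂ[T;T⁻¹] :=
  C (1 / 2) * T (-1) * (P - eulerDerivation (eulerDerivation P))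

theorem tangentFactor_ne_zero {k : ℕ} (hk : k ≠ 1) (hP : P.coeff k ≠ 0) :
    tangentFactor P ≠ 0 := by
  intro h
  have hcoeff : (tangentFactor P).coeff (k - 1) = 1 / 2 * ((1 - k ^ 2) * P.coeff k) := by
    rw [tangentFactor, mul_assoc, coeff_C_mul, coeff_T_mul, sub_neg_eq_add, sub_add_cancel]
    simp only [AddMonoidAlgebra.coeff_sub, Finsupp.sub_apply, coeff_eulerDerivation,
      Int.cast_natCast]
    ring
  have hsq : (1 - (k : ℂ) ^ 2) ≠ 0 := by
    rw [sub_ne_zero, ne_comm]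
    exact_mod_cast mt (pow_eq_one_iff.1 · |>.resolve_right two_ne_zero) hk
  rw [h] at hcoeff
  exact mul_ne_zero (by norm_num) (mul_ne_zero hsq hP) hcoeff.symm

theorem eulerDerivation_supportLaurent_zero (P : ℂ[T;T⁻¹]) :
    eulerDerivation (supportLaurent P 0) = (T 2 - 1) * tangentFactor P := by
  have hT : (T 1 : ℂ[T;T⁻¹]) = T 2 * T (-1) := by rw [← T_add]; rfl
  simp only [supportLaurent, Matrix.cons_val_zero, eulerDerivation_C_mul, map_add, map_sub,
    eulerDerivation_T_mul, Int.cast_one, Int.cast_neg, map_neg, map_one, tangentFactor]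
  rw [hT]
  ring

theorem eulerDerivation_supportLaurent_one (P : ℂ[T;T⁻¹]) :
    eulerDerivation (supportLaurent P 1) = -C Complex.I * (T 2 + 1) * tangentFactor P := by
  have hT : (T 1 : ℂ[T;T⁻¹]) = T 2 * T (-1) := by rw [← T_add]; rfl
  have hC : C (-Complex.I / 2) = -C Complex.I * C (1 / 2) := by rw [← map_neg, ← map_mul]; ring_nf
  simp only [supportLaurent, Matrix.cons_val_one, Matrix.cons_val_zero, eulerDerivation_C_mul,
    map_add, map_sub, eulerDerivation_T_mul, Int.cast_one, Int.cast_neg, map_neg, map_one,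
    tangentFactor]
  rw [hT, hC]
  ring

theorem HasPoleOrder.of_substSq {w : Fin 2 → ℂ[T;T⁻¹]} {n : ℕ}
    (h : HasPoleOrder (fun i => substSq (w i)) (2 * n)) : HasPoleOrder w n where
  coeff_eq_zero i k hk := by
    rw [← coeff_substSq_even]
    exact h.coeff_eq_zero i _ (by lia)
  coeff_ne_zero := by
    rw [← coeff_substSq_even]
    exact_mod_cast h.coeff_ne_zero
  coeff_neg_ne_zero := by
    rw [← coeff_substSq_even, mul_neg]
    exact_mod_cast h.coeff_neg_ne_zero

/-- `P` is a Laurent polynomial of degree exactly `N` in both `T` and `T⁻¹`, as is the Laurent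
polynomial in `e^{iθ}` of a real trigonometric polynomial of degree `N`. -/
structure HasLaurentDegree (P : ℂ[T;T⁻¹]) (N : ℕ) : Prop where
  coeff_eq_zero : ∀ k : ℤ, N < k.natAbs → P.coeff k = 0
  coeff_ne_zero : P.coeff N ≠ 0
  coeff_neg_ne_zero : P.coeff (-N) ≠ 0

namespace HasLaurentDegree

theorem hasPoleOrder_supportLaurent (hP : HasLaurentDegree P N) (hN : N ≠ 1) :
    HasPoleOrder (supportLaurent P) (N + 1) where
  coeff_eq_zero i k hk := by
    have h₁ : P.coeff (k - 1) = 0 := hP.coeff_eq_zero _ (by lia)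
    have h₂ : P.coeff (k + 1) = 0 := hP.coeff_eq_zero _ (by lia)
    fin_cases i
    · simp [coeff_supportLaurent_zero, h₁, h₂]
    · simp [coeff_supportLaurent_one, h₁, h₂]
  coeff_ne_zero := by
    rw [coeff_supportLaurent_one, hP.coeff_eq_zero ((N + 1 : ℕ) + 1) (by lia)]
    have hN' : (2 - (N + 1) : ℂ) ≠ 0 := by
      rw [sub_ne_zero]
      exact_mod_cast show 2 ≠ N + 1 by lia
    simp [hN', hP.coeff_ne_zero]
  coeff_neg_ne_zero := by
    rw [coeff_supportLaurent_one, hP.coeff_eq_zero (-(N + 1 : ℕ) - 1) (by lia)]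
    have hN' : (2 + (-1 + -N) : ℂ) ≠ 0 := by
      rw [← neg_add, ← sub_eq_add_neg, sub_ne_zero]
      exact_mod_cast show 2 ≠ 1 + N by lia
    simp [hN', hP.coeff_neg_ne_zero]

variable {f : MvPolynomial (Fin 2) ℝ}

theorem exists_isDefiningPolynomial (hP : HasLaurentDegree P N) (hN : N ≠ 1)
    (hp : ∀ θ, (p θ : ℂ) = laurentAeval (circleUnit θ) P) :
    ∃ f, IsDefiningPolynomial (supportCurve p) f :=
  supportCurve_eq_range hp ▸ (isLaurentParam_supportParam hp).exists_isDefiningPolynomial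
    (hP.hasPoleOrder_supportLaurent hN) N.succ_ne_zero

theorem isRationalIn_T_two (hP : HasLaurentDegree P N) (hN : N ≠ 1)
    (hp : ∀ θ, (p θ : ℂ) = laurentAeval (circleUnit θ) P) :
    IsRationalIn (supportLaurent P) (T 2) := by
  obtain ⟨f, hf⟩ := hP.exists_isDefiningPolynomial hN hp
  exact (isLaurentParam_supportParam hp).isRationalIn_T_two (supportCurve_eq_range hp ▸ hf)
    (tangentFactor_ne_zero hN hP.coeff_ne_zero) (eulerDerivation_supportLaurent_zero P)
    (eulerDerivation_supportLaurent_one P)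

theorem totalDegree_eq_of_even (hP : HasLaurentDegree P N) (hN : N ≠ 1)
    (hp : ∀ θ, (p θ : ℂ) = laurentAeval (circleUnit θ) P)
    (hf : IsDefiningPolynomial (supportCurve p) f) {k : ℤ} (hk : Even k) (hPk : P.coeff k ≠ 0) :
    f.totalDegree = 2 * (N + 1) := by
  have hmem : ¬ ∀ i, supportLaurent P i ∈ Set.range substSq := fun h =>
    hPk (forall_supportLaurent_mem_range_substSq_iff.1 h k hk)
  obtain ⟨i, hi⟩ := not_forall.1 hmem
  exact (isLaurentParam_supportParam hp).totalDegree_eq_of_notMem_range_substSq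
    (hP.hasPoleOrder_supportLaurent hN) N.succ_ne_zero (supportCurve_eq_range hp ▸ hf)
    (hP.isRationalIn_T_two hN hp) hi

theorem tracesTimes_two (hP : HasLaurentDegree P N) (hN : N ≠ 1)
    (hp : ∀ θ, (p θ : ℂ) = laurentAeval (circleUnit θ) P)
    (heven : ∀ k, Even k → P.coeff k = 0) : TracesTimes (supportParam p) 2 :=
  (isLaurentParam_supportParam hp).tracesTimes_two
    (forall_supportLaurent_mem_range_substSq_iff.2 heven) (hP.isRationalIn_T_two hN hp)

theorem totalDegree_eq_of_odd (hP : HasLaurentDegree P N) (hN : N ≠ 1)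
    (hp : ∀ θ, (p θ : ℂ) = laurentAeval (circleUnit θ) P)
    (heven : ∀ k, Even k → P.coeff k = 0) (hf : IsDefiningPolynomial (supportCurve p) f) :
    f.totalDegree = N + 1 := by
  have hodd : Odd N := by
    by_contra h
    exact hP.coeff_ne_zero (heven N (Int.even_coe_nat N |>.2 (Nat.not_odd_iff_even.1 h)))
  obtain ⟨n, hn⟩ := hodd.add_one.two_dvd
  choose w hw using forall_supportLaurent_mem_range_substSq_iff.2 heven
  have hw' : (fun i => substSq (w i)) = supportLaurent P := funext hw
  have hpole : HasPoleOrder w n := .of_substSq <| by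
    rw [hw', ← hn]
    exact hP.hasPoleOrder_supportLaurent hN
  rw [hn]
  refine IsLaurentParam.totalDegree_eq_of_substSq (w := w) ?_ hpole (by lia)
    (supportCurve_eq_range hp ▸ hf) ?_
  · exact hw' ▸ isLaurentParam_supportParam hp
  · exact hw' ▸ hP.isRationalIn_T_two hN hp

end HasLaurentDegree

section TrigPoly

variable {a b : ℕ → ℝ}

/-- The Laurent polynomial in `T = e^{iθ}` of `trigPoly N a b`. -/
noncomputable def trigLaurent (N : ℕ) (a b : ℕ → ℝ) : ℂ[T;T⁻¹] :=
  C (a 0 : ℂ) + ∑ k ∈ Finset.Icc 1 N,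
    (C ((a k - b k * Complex.I) / 2) * T k + C ((a k + b k * Complex.I) / 2) * T (-k))

theorem ofReal_trigPoly (N : ℕ) (a b : ℕ → ℝ) (θ : ℝ) :
    (trigPoly N a b θ : ℂ) = laurentAeval (circleUnit θ) (trigLaurent N a b) := by
  simp only [trigPoly, trigLaurent, map_add, map_sum, map_mul, laurentAeval_C,
    laurentAeval_circleUnit_T, Complex.ofReal_add, Complex.ofReal_sum, Complex.ofReal_mul,
    Complex.ofReal_cos, Complex.ofReal_sin, Complex.ofReal_natCast, Int.cast_natCast, Int.cast_neg,
    neg_mul, Complex.cos_neg, Complex.sin_neg, Algebra.algebraMap_self, RingHom.id_apply]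
  congr 1
  refine Finset.sum_congr rfl fun k _ => ?_
  linear_combination (b k * Complex.sin (k * θ)) * Complex.I_sq

theorem coeff_C_mul_T (r : ℂ) (m k : ℤ) :
    (C r * T m : ℂ[T;T⁻¹]).coeff k = if m = k then r else 0 := by
  rw [← single_eq_C_mul_T, AddMonoidAlgebra.coeff_single, Finsupp.single_apply]

theorem coeff_trigLaurent (N : ℕ) (a b : ℕ → ℝ) (k : ℤ) :
    (trigLaurent N a b).coeff k = (if k = 0 then (a 0 : ℂ) else 0) + ∑ m ∈ Finset.Icc 1 N,
      ((if (m : ℤ) = k then (a m - b m * Complex.I) / 2 else 0) +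
        if (-m : ℤ) = k then (a m + b m * Complex.I) / 2 else 0) := by
  simp only [trigLaurent, AddMonoidAlgebra.coeff_add, AddMonoidAlgebra.coeff_sum,
    Finsupp.add_apply, Finsupp.finsetSum_apply, C_apply, coeff_C_mul_T]

theorem coeff_trigLaurent_zero (N : ℕ) (a b : ℕ → ℝ) : (trigLaurent N a b).coeff 0 = a 0 := by
  rw [coeff_trigLaurent, if_pos rfl, add_eq_left]
  refine Finset.sum_eq_zero fun m hm => ?_
  have hm : (m : ℤ) ≠ 0 := by simp only [Finset.mem_Icc] at hm; lia
  rw [if_neg hm, if_neg (neg_ne_zero.2 hm), add_zero]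

theorem coeff_trigLaurent_of_ne_zero {k : ℤ} (hk : k ≠ 0) (N : ℕ) (a b : ℕ → ℝ) :
    (trigLaurent N a b).coeff k = if k.natAbs ≤ N then
      (if 0 < k then (a k.natAbs - b k.natAbs * Complex.I) / 2 else
        (a k.natAbs + b k.natAbs * Complex.I) / 2) else 0 := by
  have hterm (m : ℕ) : ((if (m : ℤ) = k then (a m - b m * Complex.I) / 2 else 0) +
        if (-m : ℤ) = k then (a m + b m * Complex.I) / 2 else 0) =
      if m = k.natAbs then (if 0 < k then (a m - b m * Complex.I) / 2 else
        (a m + b m * Complex.I) / 2) else 0 := by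
    split_ifs <;> first | lia | simp
  rw [coeff_trigLaurent, if_neg hk, zero_add, Finset.sum_congr rfl fun m _ => hterm m,
    Finset.sum_ite_eq']
  simp only [Finset.mem_Icc, Nat.one_le_iff_ne_zero, Int.natAbs_ne_zero.2 hk, ne_eq,
    not_false_eq_true, true_and]

theorem coeff_trigLaurent_eq_zero_iff {k : ℤ} (hk : k ≠ 0) :
    (trigLaurent N a b).coeff k = 0 ↔ k.natAbs ≤ N → a k.natAbs = 0 ∧ b k.natAbs = 0 := by
  rw [coeff_trigLaurent_of_ne_zero hk]
  split_ifs <;> simp [Complex.ext_iff, *]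

theorem hasLaurentDegree_trigLaurent (hN : N ≠ 0) (hlead : a N ≠ 0 ∨ b N ≠ 0) :
    HasLaurentDegree (trigLaurent N a b) N := by
  have hlead' : ¬ (a N = 0 ∧ b N = 0) := by rwa [not_and_or]
  refine ⟨fun k hk => ?_, ?_, ?_⟩
  · rw [coeff_trigLaurent_eq_zero_iff (by lia)]
    lia
  · rw [Ne, coeff_trigLaurent_eq_zero_iff (by lia)]
    simpa using hlead'
  · rw [Ne, coeff_trigLaurent_eq_zero_iff (by lia)]
    simpa using hlead'

theorem forall_even_coeff_trigLaurent_eq_zero_iff :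
    (∀ k, Even k → (trigLaurent N a b).coeff k = 0) ↔
      a 0 = 0 ∧ ∀ k, 1 ≤ k → 2 * k ≤ N → a (2 * k) = 0 ∧ b (2 * k) = 0 := by
  constructor
  · intro h
    refine ⟨by simpa [coeff_trigLaurent_zero] using h 0 Even.zero, fun k hk hkN => ?_⟩
    have := h (2 * k : ℕ) (by simp)
    rw [coeff_trigLaurent_eq_zero_iff (by lia)] at this
    exact this hkN
  · rintro ⟨h₀, h⟩ k hk
    obtain rfl | hk0 := eq_or_ne k 0
    · rw [coeff_trigLaurent_zero, h₀, Complex.ofReal_zero]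
    · obtain ⟨m, hm⟩ := (Int.natAbs_even.2 hk).two_dvd
      rw [coeff_trigLaurent_eq_zero_iff hk0, hm]
      exact h m (by lia)

end TrigPoly

end SupportCurve

theorem theorem2p1 (N : ℕ) (hN : 2 ≤ N) (a b : ℕ → ℝ) (hlead : a N ≠ 0 ∨ b N ≠ 0) :
    ((a 0 ≠ 0 ∨ ∃ k : ℕ, 1 ≤ k ∧ 2 * k ≤ N ∧ (a (2 * k) ≠ 0 ∨ b (2 * k) ≠ 0)) →
      (∃ f, IsDefiningPolynomial (supportCurve (trigPoly N a b)) f) ∧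
      ∀ f, IsDefiningPolynomial (supportCurve (trigPoly N a b)) f →
        f.totalDegree = 2 * N + 2) ∧
    ((a 0 = 0 ∧ ∀ k : ℕ, 1 ≤ k → 2 * k ≤ N → a (2 * k) = 0 ∧ b (2 * k) = 0) →
      TracesTimes (supportParam (trigPoly N a b)) 2 ∧
      (∃ f, IsDefiningPolynomial (supportCurve (trigPoly N a b)) f) ∧
      ∀ f, IsDefiningPolynomial (supportCurve (trigPoly N a b)) f →
        f.totalDegree = N + 1) := by
  have hN₁ : N ≠ 1 := by lia
  have hp := ofReal_trigPoly N a b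
  have hP : HasLaurentDegree (trigLaurent N a b) N :=
    hasLaurentDegree_trigLaurent (by lia) hlead
  constructor
  · intro hne
    obtain ⟨k, hk, hPk⟩ : ∃ k, Even k ∧ (trigLaurent N a b).coeff k ≠ 0 := by
      contrapose! hne
      exact forall_even_coeff_trigLaurent_eq_zero_iff.1 hne
    exact ⟨hP.exists_isDefiningPolynomial hN₁ hp,
      fun f hf => hP.totalDegree_eq_of_even hN₁ hp hf hk hPk⟩
  · intro hzero
    have heven := forall_even_coeff_trigLaurent_eq_zero_iff.2 hzero
    exact ⟨hP.tracesTimes_two hN₁ hp heven, hP.exists_isDefiningPolynomial hN₁ hp,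
      fun f hf => hP.totalDegree_eq_of_odd hN₁ hp heven hf⟩
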